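/- Let $M$ be a connected, oriented, smooth three-manifold without boundary (not necessarily compact), let $g$ be a smooth Riemannian metric on $M$, and let $\kappa>0$. Let $\mathrm{Ric}^g$, $s_g$, $\nabla^g$, $\ast_g$ and $\delta^g=-\mathrm{Tr}_g\nabla^g$ denote the Ricci tensor, the scalar curvature, the Levi-Civita connection, the Hodge operator and the codifferential on one-forms of $g$. Let $\varphi$ be a smooth closed one-form and let $f$ be a smooth real function on $M$ such that $(g,\varphi,f)$ is a three-dimensional Heterotic soliton with parameter $\kappa$ and dilaton $f$, that is, $$-\kappa\,\mathrm{Ric}^g\circ_g\mathrm{Ric}^g+\Big(1+\kappa s_g-\frac{\kappa}{2}f^2\Big)\mathrm{Ric}^g+\Big(\kappa|\mathrm{Ric}^g|_g^2-\frac{\kappa}{2}s_g^2+\frac{\kappa}{4}|\mathrm{d}f|_g^2-\frac12 f^2+\frac{\kappa}{8}f^4\Big)g+\frac{\kappa}{2}[\ast_g\mathrm{d}f,\mathrm{Ric}^g]+\frac{\kappa}{4}\mathrm{d}f\otimes\mathrm{d}f+\nabla^g\varphi=0,$$ $$f\varphi=\mathrm{d}f,\qquad s_g=3\,\delta^g\varphi+2|\varphi|_g^2-\frac12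 f^2 .$$ Here $(\mathrm{Ric}^g\circ_g\mathrm{Ric}^g)(u,v)=g(\mathrm{Ric}^g(u),\mathrm{Ric}^g(v))$, $|\mathrm{Ric}^g|_g^2=\mathrm{Tr}_g(\mathrm{Ric}^g\circ_g\mathrm{Ric}^g)$, and $[\cdot,\cdot]$ is the commutator of the endomorphisms of $TM$ that correspond to the two tensors under $g$, regarded again as a bilinear form. If $g$ is Einstein, that is, $\mathrm{Ric}^g=\lambda g$ for a constant $\lambda\in\mathbb{R}$, then the dilaton $f$ is constant. -/

import Mathlib

open Bundle Manifold ContDiff Topology VectorField FiberBundle Module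

noncomputable section

namespace HeteroticSoliton

/-! ### Riemannian geometry

Throughout, `M` is a smooth manifold with a smooth Riemannian metric on its tangent bundle; the
metric is written `inner ℝ u v` on each tangent space. -/

section Riemannian

variable {E : Type*} [NormedAddCommGroup E] [NormedSpace ℝ E] [FiniteDimensional ℝ E]
  {H : Type*} [TopologicalSpace H] {I : ModelWithCorners ℝ E H}
  {M : Type*} [TopologicalSpace M] [ChartedSpace H M] [IsManifold I ∞ M]
  [RiemannianBundle (fun x : M => TangentSpace I x)]
  [IsContMDiffRiemannianBundle I ∞ E (fun x : M => TangentSpace I x)]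

instance instFiniteDimensionalTangentSpace (x : M) : FiniteDimensional ℝ (TangentSpace I x) :=
  inferInstanceAs (FiniteDimensional ℝ E)

/-- The right-hand side of the Koszul formula for `⟨∇_X Y, Z⟩` at the point `x`. -/
def koszul (X Y Z : ∀ x : M, TangentSpace I x) (x : M) : ℝ :=
  (1 / 2) * (d% (fun y => inner ℝ (Y y) (Z y)) x (X x)
    + d% (fun y => inner ℝ (X y) (Z y)) x (Y x)
    - d% (fun y => inner ℝ (X y) (Y y)) x (Z x)
    + inner ℝ (mlieBracket I X Y x) (Z x)
    - inner ℝ (mlieBracket I X Z x) (Y x)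
    - inner ℝ (mlieBracket I Y Z x) (X x))

theorem mdiffAt_inner {X Y : ∀ x : M, TangentSpace I x} {x : M}
    (hX : MDiffAt (T% X) x) (hY : MDiffAt (T% Y) x) :
    MDiffAt (fun y => inner ℝ (X y) (Y y)) x :=
  MDifferentiableAt.inner_bundle (IB := I) (F := E) (E := fun x : M => TangentSpace I x)
    (b := fun x => x) hX hY

theorem koszul_tensorial_left {Y Z : ∀ x : M, TangentSpace I x} {x : M}
    (hY : MDiffAt (T% Y) x) (hZ : MDiffAt (T% Z) x) :
    TensorialAt I E (fun X => koszul X Y Z x) x where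
  smul {f X} hf hX := by
    have : CompleteSpace E := FiniteDimensional.complete ℝ E
    simp [koszul, inner_smul_left, mvfderiv_fun_mul hf (mdiffAt_inner hX hZ),
      mvfderiv_fun_mul hf (mdiffAt_inner hX hY), mlieBracket_smul_left hf hX,
      inner_add_left, inner_smul_right]
    rw [real_inner_comm (Z x) (X x), real_inner_comm (Y x) (X x)]
    ring
  add {X X'} hX hX' := by
    have : CompleteSpace E := FiniteDimensional.complete ℝ E
    simp [koszul, mlieBracket_add_left hX hX', inner_add_left, inner_add_right,
      mvfderiv_fun_add (mdiffAt_inner hX hZ) (mdiffAt_inner hX' hZ),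
      mvfderiv_fun_add (mdiffAt_inner hX hY) (mdiffAt_inner hX' hY)]
    ring

theorem koszul_tensorial_right {X Y : ∀ x : M, TangentSpace I x} {x : M}
    (hX : MDiffAt (T% X) x) (hY : MDiffAt (T% Y) x) :
    TensorialAt I E (fun Z => koszul X Y Z x) x where
  smul {f Z} hf hZ := by
    have : CompleteSpace E := FiniteDimensional.complete ℝ E
    simp [koszul, inner_smul_right, mvfderiv_fun_mul hf (mdiffAt_inner hX hZ),
      mvfderiv_fun_mul hf (mdiffAt_inner hY hZ), mlieBracket_smul_right hf hZ,
      inner_add_left, real_inner_comm, inner_smul_left]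
    ring
  add {Z Z'} hZ hZ' := by
    have : CompleteSpace E := FiniteDimensional.complete ℝ E
    simp [koszul, mlieBracket_add_right hZ hZ', inner_add_left, inner_add_right,
      mvfderiv_fun_add (mdiffAt_inner hX hZ) (mdiffAt_inner hX hZ'),
      mvfderiv_fun_add (mdiffAt_inner hY hZ) (mdiffAt_inner hY hZ')]
    ring

theorem koszul_add {X Y Y' Z : ∀ x : M, TangentSpace I x} {x : M}
    (hX : MDiffAt (T% X) x) (hY : MDiffAt (T% Y) x) (hY' : MDiffAt (T% Y') x)
    (hZ : MDiffAt (T% Z) x) :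
    koszul X (Y + Y') Z x = koszul X Y Z x + koszul X Y' Z x := by
  have : CompleteSpace E := FiniteDimensional.complete ℝ E
  simp [koszul, mlieBracket_add_right hY hY', mlieBracket_add_left hY hY',
    inner_add_left, inner_add_right,
    mvfderiv_fun_add (mdiffAt_inner hX hY) (mdiffAt_inner hX hY'),
    mvfderiv_fun_add (mdiffAt_inner hY hZ) (mdiffAt_inner hY' hZ)]
  ring

theorem koszul_smul {X Y Z : ∀ x : M, TangentSpace I x} {f : M → ℝ} {x : M}
    (hf : MDiffAt f x) (hX : MDiffAt (T% X) x) (hY : MDiffAt (T% Y) x)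
    (hZ : MDiffAt (T% Z) x) :
    koszul X (f • Y) Z x = f x * koszul X Y Z x + d% f x (X x) * inner ℝ (Y x) (Z x) := by
  have : CompleteSpace E := FiniteDimensional.complete ℝ E
  simp [koszul, mlieBracket_smul_right hf hY, mlieBracket_smul_left hf hY,
    inner_add_left, inner_smul_left, inner_smul_right,
    mvfderiv_fun_mul hf (mdiffAt_inner hX hY),
    mvfderiv_fun_mul hf (mdiffAt_inner hY hZ), real_inner_comm]
  ring

open Classical in
/-- The Levi-Civita covariant derivative of a vector field `Y`: at a point `x` where `Y` is
differentiable, `u ↦ ∇_u Y` is the endomorphism determined by the Koszul formula. -/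
def leviCivitaFun (Y : ∀ x : M, TangentSpace I x) (x : M) :
    TangentSpace I x →L[ℝ] TangentSpace I x :=
  if hY : MDiffAt (T% Y) x then
    ((InnerProductSpace.toDual ℝ (TangentSpace I x)).symm.toContinuousLinearEquiv :
        (TangentSpace I x →L[ℝ] ℝ) →L⋆[ℝ] TangentSpace I x).comp <|
      TensorialAt.mkHom₂ (fun X Z => koszul X Y Z x) x
        (fun _ hZ => koszul_tensorial_left hY hZ) (fun _ hX => koszul_tensorial_right hX hY)
  else 0

theorem inner_leviCivitaFun {Y : ∀ x : M, TangentSpace I x} {x : M}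
    (hY : MDiffAt (T% Y) x) (u v : TangentSpace I x) :
    inner ℝ (leviCivitaFun Y x u) v = koszul (extend E u) Y (extend E v) x := by
  simp [leviCivitaFun, dif_pos hY, TensorialAt.mkHom₂_apply_eq_extend]

theorem isCovariantDerivativeOn_leviCivitaFun :
    IsCovariantDerivativeOn E (leviCivitaFun (I := I) (M := M)) where
  add {Y Y' x} hY hY' _ := by
    ext u
    refine ext_inner_right ℝ fun v => ?_
    have hu := mdifferentiableAt_extend I E u
    have hv := mdifferentiableAt_extend I E v
    rw [inner_leviCivitaFun (mdifferentiableAt_add_section hY hY'), koszul_add hu hY hY' hv,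
      add_apply, inner_add_left, inner_leviCivitaFun hY, inner_leviCivitaFun hY']
  leibniz {Y f x} hY hf _ := by
    ext u
    refine ext_inner_right ℝ fun v => ?_
    have hu := mdifferentiableAt_extend I E u
    have hv := mdifferentiableAt_extend I E v
    rw [inner_leviCivitaFun (hf.smul_section hY), koszul_smul hf hu hY hv]
    simp [inner_add_left, inner_smul_left, inner_leviCivitaFun hY]

/-- The Levi-Civita connection of the Riemannian metric. -/
def leviCivita : CovariantDerivative I E (fun x : M => TangentSpace I x) where
  toFun := leviCivitaFun
  isCovariantDerivativeOnUniv := isCovariantDerivativeOn_leviCivitaFun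

/-- The defining property of the Levi-Civita connection: the Koszul formula. -/
theorem inner_leviCivita {X Y Z : ∀ x : M, TangentSpace I x} {x : M}
    (hX : MDiffAt (T% X) x) (hY : MDiffAt (T% Y) x) (hZ : MDiffAt (T% Z) x) :
    inner ℝ (leviCivita Y x (X x)) (Z x) = koszul X Y Z x := by
  have h : inner ℝ (leviCivita Y x (X x)) (Z x) =
      koszul (extend E (X x)) Y (extend E (Z x)) x := inner_leviCivitaFun hY _ _
  rw [h, ← TensorialAt.mkHom₂_apply_eq_extend (Φ := fun X Z => koszul X Y Z x)
    (fun _ hZ => koszul_tensorial_left hY hZ) (fun _ hX => koszul_tensorial_right hX hY)]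
  exact TensorialAt.mkHom₂_apply _ _ hX hZ

/-- The Levi-Civita connection is compatible with the metric. -/
theorem leviCivita_metric {X Y Z : ∀ x : M, TangentSpace I x} {x : M}
    (hX : MDiffAt (T% X) x) (hY : MDiffAt (T% Y) x) (hZ : MDiffAt (T% Z) x) :
    d% (fun y => inner ℝ (Y y) (Z y)) x (X x) =
      inner ℝ (leviCivita Y x (X x)) (Z x) + inner ℝ (Y x) (leviCivita Z x (X x)) := by
  rw [real_inner_comm (leviCivita Z x (X x)) (Y x), inner_leviCivita hX hY hZ,
    inner_leviCivita hX hZ hY]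
  simp only [koszul, mlieBracket_swap_apply (V := Z) (W := Y), inner_neg_left]
  simp only [real_inner_comm]
  ring

/-- The Levi-Civita connection is torsion-free. -/
theorem leviCivita_torsion {X Y : ∀ x : M, TangentSpace I x} {x : M}
    (hX : MDiffAt (T% X) x) (hY : MDiffAt (T% Y) x) :
    leviCivita Y x (X x) - leviCivita X x (Y x) = mlieBracket I X Y x := by
  refine ext_inner_right ℝ fun v => ?_
  have hv := mdifferentiableAt_extend I E v
  have hv' : extend E v x = v := extend_apply_self E v
  rw [← hv', inner_sub_left, inner_leviCivita hX hY hv, inner_leviCivita hY hX hv]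
  simp only [koszul, mlieBracket_swap_apply (V := Y) (W := X), inner_neg_left]
  simp only [real_inner_comm]
  ring

/-- The curvature `R_{u,v} w = ∇_u ∇_v w - ∇_v ∇_u w - ∇_{[u,v]} w` of the Levi-Civita connection,
computed with smooth local extensions of the tangent vectors `u`, `v`, `w` at `x`. -/
def curvature (x : M) (u v w : TangentSpace I x) : TangentSpace I x :=
  let U : ∀ y : M, TangentSpace I y := extend E u
  let V : ∀ y : M, TangentSpace I y := extend E v
  let W : ∀ y : M, TangentSpace I y := extend E w
  leviCivita (fun y => leviCivita W y (V y)) x u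
    - leviCivita (fun y => leviCivita W y (U y)) x v
    - leviCivita W x (mlieBracket I U V x)

/-- The trace of a `(0,2)`-tensor with respect to the metric. -/
def metricTrace (x : M) (τ : TangentSpace I x → TangentSpace I x → ℝ) : ℝ :=
  ∑ i, τ (stdOrthonormalBasis ℝ (TangentSpace I x) i) (stdOrthonormalBasis ℝ (TangentSpace I x) i)

/-- The endomorphism `A` that corresponds to a `(0,2)`-tensor `τ` under the metric:
`⟨A u, v⟩ = τ u v`. -/
def toEnd (x : M) (τ : TangentSpace I x → TangentSpace I x → ℝ) (u : TangentSpace I x) :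
    TangentSpace I x :=
  ∑ i, τ u (stdOrthonormalBasis ℝ (TangentSpace I x) i) •
    stdOrthonormalBasis ℝ (TangentSpace I x) i

/-- The commutator `[τ₁, τ₂]` of the endomorphisms that correspond to two `(0,2)`-tensors, again
regarded as a `(0,2)`-tensor. -/
def endCommutator (x : M) (τ₁ τ₂ : TangentSpace I x → TangentSpace I x → ℝ)
    (u v : TangentSpace I x) : ℝ :=
  inner ℝ (toEnd x τ₁ (toEnd x τ₂ u) - toEnd x τ₂ (toEnd x τ₁ u)) v

/-- The Ricci tensor `Ric(u, v) = tr (w ↦ R_{w,u} v)`. -/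
def ric (x : M) (u v : TangentSpace I x) : ℝ :=
  metricTrace x fun w w' => inner ℝ (curvature x w u v) w'

variable (I) in
/-- The scalar curvature. -/
def scal (x : M) : ℝ :=
  metricTrace x (ric (I := I) x)

/-- `(Ric ∘ Ric)(u, v) = ⟨Ric u, Ric v⟩`. -/
def ricSq (x : M) (u v : TangentSpace I x) : ℝ :=
  inner ℝ (toEnd x (ric x) u) (toEnd x (ric x) v)

variable (I) in
/-- The squared norm `|Ric|²` of the Ricci tensor. -/
def normSqRic (x : M) : ℝ :=
  metricTrace x (ricSq (I := I) x)

variable (I M) in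
/-- The metric is Einstein: the Ricci tensor is a constant multiple of the metric. -/
def IsEinstein : Prop :=
  ∃ c : ℝ, ∀ (x : M) (u v : TangentSpace I x), ric x u v = c * inner ℝ u v

/-! ### One-forms -/

/-- Smoothness of a one-form, as a section of the cotangent bundle. -/
def IsSmoothOneForm (φ : ∀ x : M, TangentSpace I x →L[ℝ] ℝ) : Prop :=
  ContMDiff I (I.prod 𝓘(ℝ, E →L[ℝ] ℝ)) ∞
    (fun x => TotalSpace.mk' (E →L[ℝ] ℝ)
      (E := fun x : M => TangentSpace I x →L[ℝ] Bundle.Trivial M ℝ x) x (φ x))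

/-- A one-form is closed: `dφ(u, v) = u(φ(V)) - v(φ(U)) - φ([U, V]) = 0`, for smooth local
extensions `U`, `V` of the tangent vectors `u`, `v`. -/
def IsClosedOneForm (φ : ∀ x : M, TangentSpace I x →L[ℝ] ℝ) : Prop :=
  ∀ (x : M) (u v : TangentSpace I x),
    d% (fun y => φ y (extend E v y)) x u - d% (fun y => φ y (extend E u y)) x v
      - φ x (mlieBracket I (extend E u) (extend E v) x) = 0

/-- The covariant derivative of a one-form, `(∇_u φ)(v) = u(φ(V)) - φ(∇_u V)`, where `V` is a
smooth local extension of the tangent vector `v`. -/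
def covDeriv (φ : ∀ x : M, TangentSpace I x →L[ℝ] ℝ) (x : M) (u v : TangentSpace I x) : ℝ :=
  d% (fun y => φ y (extend E v y)) x u - φ x (leviCivita (extend E v) x u)

/-- The codifferential `δφ = -tr ∇φ` of a one-form. -/
def codiff (φ : ∀ x : M, TangentSpace I x →L[ℝ] ℝ) (x : M) : ℝ :=
  -metricTrace x (covDeriv φ x)

/-- The squared norm of a covector. -/
def normSq {x : M} (α : TangentSpace I x →L[ℝ] ℝ) : ℝ :=
  metricTrace x fun u v => α u * α v

end Riemannian

/-! ### Orientation and the Hodge dual of a one-form in dimension three -/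

section Dim3

variable {E : Type*} [NormedAddCommGroup E] [NormedSpace ℝ E] [FiniteDimensional ℝ E]
  [Fact (finrank ℝ E = 3)]
  {H : Type*} [TopologicalSpace H] {I : ModelWithCorners ℝ E H}
  {M : Type*} [TopologicalSpace M] [ChartedSpace H M] [IsManifold I ∞ M]

variable (I M) in
/-- An orientation of a three-manifold: an orientation of each tangent space, locally constant in
the local trivializations of the tangent bundle that come from the charts. -/
structure ManifoldOrientation where
  /-- The orientation of the tangent space at a point. -/
  toFun : ∀ x : M, Orientation ℝ (TangentSpace I x) (Fin 3)
  locallyConstant : ∀ x₀ : M, ∀ᶠ x in 𝓝 x₀,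
    ∀ hx : x ∈ (trivializationAt E (fun y : M => TangentSpace I y) x₀).baseSet,
      Orientation.map (Fin 3)
        ((trivializationAt E (fun y : M => TangentSpace I y) x₀).continuousLinearEquivAt
          ℝ x hx).toLinearEquiv (toFun x) =
      Orientation.map (Fin 3)
        ((trivializationAt E (fun y : M => TangentSpace I y) x₀).continuousLinearEquivAt
          ℝ x₀ (mem_baseSet_trivializationAt E _ x₀)).toLinearEquiv (toFun x₀)

instance instFactFinrankTangentSpace (x : M) : Fact (finrank ℝ (TangentSpace I x) = 3) :=
  inferInstanceAs (Fact (finrank ℝ E = 3))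

instance instFactFinrankEuclideanSpace : Fact (finrank ℝ (EuclideanSpace ℝ (Fin 3)) = 3) :=
  ⟨finrank_euclideanSpace_fin⟩

variable [RiemannianBundle (fun x : M => TangentSpace I x)]
  [IsContMDiffRiemannianBundle I ∞ E (fun x : M => TangentSpace I x)]

/-- The Hodge dual `*α` of a one-form in dimension three: the contraction of the Riemannian volume
form with the vector dual to `α`. -/
def hodgeStar (o : ManifoldOrientation I M) {x : M} (α : TangentSpace I x →L[ℝ] ℝ)
    (u v : TangentSpace I x) : ℝ :=
  (o.toFun x).volumeForm ![(InnerProductSpace.toDual ℝ (TangentSpace I x)).symm α, u, v]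

/-! ### The three-dimensional Heterotic soliton system -/

/-- The Riemannian metric `g` of `M`, the one-form `φ` and the function `f` (the dilaton) form a
three-dimensional Heterotic soliton with parameter `κ`. -/
structure IsHeteroticSoliton (o : ManifoldOrientation I M) (κ : ℝ)
    (φ : ∀ x : M, TangentSpace I x →L[ℝ] ℝ) (f : M → ℝ) : Prop where
  smooth_form : IsSmoothOneForm φ
  closed_form : IsClosedOneForm φ
  smooth_fun : ContMDiff I 𝓘(ℝ) ∞ f
  einstein_eq : ∀ (x : M) (u v : TangentSpace I x),
    -κ * ricSq x u v
      + (1 + κ * scal I x - κ / 2 * f x ^ 2) * ric x u v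
      + (κ * normSqRic I x - κ / 2 * scal I x ^ 2 + κ / 4 * normSq (d% f x)
          - 1 / 2 * f x ^ 2 + κ / 8 * f x ^ 4) * inner ℝ u v
      + κ / 2 * endCommutator x (hodgeStar o (d% f x)) (ric x) u v
      + κ / 4 * (d% f x u * d% f x v)
      + covDeriv φ x u v = 0
  maxwell_eq : ∀ x : M, f x • φ x = d% f x
  dilaton_eq : ∀ x : M, scal I x = 3 * codiff φ x + 2 * normSq (φ x) - 1 / 2 * f x ^ 2

end Dim3

end HeteroticSoliton

end

namespace HeteroticSoliton

/-! ### First-order calculus for real functions on a boundaryless manifold. -/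

section Calculus

variable {E : Type*} [NormedAddCommGroup E] [NormedSpace ℝ E]
  {H : Type*} [TopologicalSpace H] {I : ModelWithCorners ℝ E H}
  {M : Type*} [TopologicalSpace M] [ChartedSpace H M]

/-! Let `Ric = c g`. The commutator term vanishes, since a multiple of the identity commutes with
everything, and `df = f φ`, so the Einstein equation becomes `∇φ = -(A(f) + (κ/4) f² |φ|²) g - (κ/4)
f² φ ⊗ φ` with `A` a polynomial (`covDeriv_eq`). Its trace, inserted in the dilaton equation, gives
`|φ|² = B(f)/D(f)` with `D = 2 + 3κf² > 0` (`normSq_form`).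

Now `d|φ|²` can be computed twice where `φ ≠ 0`: as `(B/D)'(f) f φ` by the chain rule, and as `2
∇φ(·, φ♯)` (`mvfderiv_normSq`), again a multiple of `φ`. Equating the two, clearing `D²` and
multiplying by `f` yields `p(f) df = 0`, where `p` has degree 8 with leading coefficient `9κ³/8 ≠
0`. Where `φ = 0`, also `df = 0`. If `f` were not constant on the connected manifold, its range
would contain an interval on which `p` vanishes. -/

theorem mvfderiv_eq_zero_of_isLocalMin [I.Boundaryless] {h : M → ℝ} {x : M}
    (hd : MDiffAt h x) (hmin : IsLocalMin h x) : d% h x = 0 := by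
  rw [hd.mvfderiv, I.range_eq_univ, fderivWithin_univ]
  refine IsLocalMin.fderiv_eq_zero ?_
  have hx : (extChartAt I x).symm (extChartAt I x x) = x := extChartAt_to_inv x
  have hw : writtenInExtChartAt I 𝓘(ℝ, ℝ) x h = fun z => h ((extChartAt I x).symm z) := rfl
  rw [hw]
  have hc : Filter.Tendsto (extChartAt I x).symm (𝓝 (extChartAt I x x)) (𝓝 x) := by
    simpa only [ContinuousAt, hx] using continuousAt_extChartAt_symm (I := I) x
  filter_upwards [hc.eventually hmin] with y hy
  rwa [hx]

theorem mvfderiv_comp_of_hasDerivAt {G : ℝ → ℝ} {G' : ℝ} {f : M → ℝ} {x : M}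
    (hG : HasDerivAt G G' (f x)) (hf : MDiffAt f x) :
    MDiffAt (fun y => G (f y)) x ∧ d% (fun y => G (f y)) x = G' • d% f x := by
  have h := hG.hasFDerivAt.hasMFDerivAt.comp x hf.hasMFDerivAt
  refine ⟨h.mdifferentiableAt, ?_⟩
  ext v
  have := h.mfderiv
  simp only [mvfderiv]
  change (mfderiv I 𝓘(ℝ, ℝ) (G ∘ f) x) v = _
  rw [this]
  exact @mul_comm ℝ _ _ _

theorem isLocallyConstant_of_mvfderiv_eq_zero [I.Boundaryless] [IsManifold I 1 M] {h : M → ℝ}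
    (hd : MDiff h) (h0 : ∀ x, d% h x = 0) : IsLocallyConstant h := by
  rw [IsLocallyConstant.iff_eventually_eq]
  intro x
  have hopen : (extChartAt I x).target ∈ 𝓝 (extChartAt I x x) := extChartAt_target_mem_nhds x
  obtain ⟨r, hr, hball⟩ := Metric.mem_nhds_iff.1 hopen
  -- A ball is used because the chart target need not be connected.
  have key : ∀ z ∈ Metric.ball (extChartAt I x x) r,
      HasFDerivAt (fun z => h ((extChartAt I x).symm z)) (0 : E →L[ℝ] ℝ) z := by
    intro z hz
    have h1 : MDifferentiableAt 𝓘(ℝ, E) I (extChartAt I x).symm z := by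
      have := mdifferentiableWithinAt_extChartAt_symm (I := I) (hball hz)
      rwa [I.range_eq_univ, mdifferentiableWithinAt_univ] at this
    have h3 : mfderiv I 𝓘(ℝ, ℝ) h ((extChartAt I x).symm z) = 0 := by
      ext v
      exact DFunLike.congr_fun (h0 ((extChartAt I x).symm z)) v
    have h2 := (hd ((extChartAt I x).symm z)).hasMFDerivAt
    rw [h3] at h2
    have h4 := h2.comp z h1.hasMFDerivAt
    rw [ContinuousLinearMap.zero_comp] at h4
    exact h4.hasFDerivAt
  have hpre : (extChartAt I x) ⁻¹' Metric.ball (extChartAt I x x) r ∈ 𝓝 x :=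
    (continuousAt_extChartAt x).preimage_mem_nhds (Metric.ball_mem_nhds _ hr)
  filter_upwards [hpre, extChartAt_source_mem_nhds (I := I) x] with y hy hys
  have := Metric.isOpen_ball.is_const_of_fderiv_eq_zero (𝕜 := ℝ)
    (convex_ball (extChartAt I x x) r).isPreconnected
    (fun z hz => (key z hz).differentiableAt.differentiableWithinAt)
    (fun z hz => (key z hz).fderiv) hy (Metric.mem_ball_self hr)
  rwa [(extChartAt I x).left_inv hys, extChartAt_to_inv] at this

/-- On a connected manifold, a differentiable function `f` with `p(f) df = 0` for some nonzero
polynomial `p` is constant. -/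
theorem exists_eq_const_of_polynomial_smul_mvfderiv_eq_zero [I.Boundaryless] [IsManifold I 1 M]
    [ConnectedSpace M] {f : M → ℝ} (hf : MDiff f) {p : Polynomial ℝ} (hp : p ≠ 0)
    (h : ∀ x, p.eval (f x) • d% f x = 0) : ∃ c, ∀ x, f x = c := by
  -- With `P' = p`, the hypothesis says `d(P ∘ f) = 0`. Hence `P` is constant on the range of `f`,
  -- an interval, and `p` vanishes in its interior.
  let P : ℝ → ℝ := fun y => ∫ t in (0 : ℝ)..y, p.eval t
  have hP : ∀ y, HasDerivAt P (p.eval y) y := fun y =>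
    p.continuous.integral_hasStrictDerivAt 0 y |>.hasDerivAt
  have hlc : IsLocallyConstant (fun x => P (f x)) :=
    isLocallyConstant_of_mvfderiv_eq_zero (I := I)
      (fun x => (mvfderiv_comp_of_hasDerivAt (hP (f x)) (hf x)).1)
      (fun x => (mvfderiv_comp_of_hasDerivAt (hP (f x)) (hf x)).2.trans (h x))
  obtain ⟨x₀⟩ := (inferInstance : Nonempty M)
  refine ⟨f x₀, fun x => ?_⟩
  by_contra hne
  have hconn : (Set.range f).OrdConnected :=
    (isPreconnected_range (hf.continuous)).ordConnected
  have hsub : Set.uIcc (f x₀) (f x) ⊆ Set.range f :=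
    hconn.uIcc_subset (Set.mem_range_self x₀) (Set.mem_range_self x)
  have hPc : ∀ y ∈ Set.range f, P y = P (f x₀) := by
    rintro _ ⟨z, rfl⟩
    exact hlc.apply_eq_of_preconnectedSpace z x₀
  refine hp (p.eq_zero_of_infinite_isRoot ?_)
  have hlt : min (f x₀) (f x) < max (f x₀) (f x) := min_lt_max.2 (Ne.symm hne)
  refine (Set.Ioo_infinite hlt).mono fun y hy => ?_
  have hev : P =ᶠ[𝓝 y] fun _ => P (f x₀) := by
    filter_upwards [Ioo_mem_nhds hy.1 hy.2] with z hz
    exact hPc z (hsub ⟨hz.1.le, hz.2.le⟩)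
  exact (hP y).unique ((hasDerivAt_const y _).congr_of_eventuallyEq hev)

end Calculus

/-! ### Norms of one-forms and the derivative of `|φ|²`. -/

section Riemannian

variable {E : Type*} [NormedAddCommGroup E] [NormedSpace ℝ E] [FiniteDimensional ℝ E]
  {H : Type*} [TopologicalSpace H] {I : ModelWithCorners ℝ E H}
  {M : Type*} [TopologicalSpace M] [ChartedSpace H M] [IsManifold I ∞ M]

theorem IsSmoothOneForm.mdiffAt_apply {φ : ∀ x : M, TangentSpace I x →L[ℝ] ℝ}
    (hφ : IsSmoothOneForm φ) {V : ∀ x : M, TangentSpace I x} {x : M} (hV : MDiffAt (T% V) x) :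
    MDiffAt (fun y => φ y (V y)) x := by
  have h1 := (hφ x).mdifferentiableAt (by simp)
  have h2 := MDifferentiableAt.clm_bundle_apply (F₁ := E) (F₂ := ℝ)
    (E₁ := fun x : M => TangentSpace I x) (E₂ := Bundle.Trivial M ℝ) (b := fun y => y)
    (v := V) (ϕ := φ) h1 hV
  rw [mdifferentiableAt_totalSpace] at h2
  simpa using h2.2

variable [RiemannianBundle (fun x : M => TangentSpace I x)]

theorem normSq_eq {x : M} (α : TangentSpace I x →L[ℝ] ℝ) :
    normSq α = ‖(InnerProductSpace.toDual ℝ (TangentSpace I x)).symm α‖ ^ 2 := by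
  rw [← (stdOrthonormalBasis ℝ (TangentSpace I x)).sum_sq_inner_left]
  simp [normSq, metricTrace, sq]

theorem metricTrace_inner (x : M) :
    metricTrace x (fun u v : TangentSpace I x => inner ℝ u v) = finrank ℝ E := by
  simp [metricTrace]
  rfl

variable [IsContMDiffRiemannianBundle I ∞ E (fun x : M => TangentSpace I x)]

/-- The derivative of the squared norm of a one-form `φ` is `2 ∇φ(·, φ♯)` where `φ` does not
vanish. -/
theorem mvfderiv_normSq [I.Boundaryless] {φ : ∀ x : M, TangentSpace I x →L[ℝ] ℝ}
    (hφ : IsSmoothOneForm φ) {x : M} (hd : MDiffAt (fun y => normSq (φ y)) x) (h0 : φ x ≠ 0)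
    (u : TangentSpace I x) :
    d% (fun y => normSq (φ y)) x u =
      2 * covDeriv φ x u ((InnerProductSpace.toDual ℝ (TangentSpace I x)).symm (φ x)) := by
  set v := (InnerProductSpace.toDual ℝ (TangentSpace I x)).symm (φ x) with hv
  have hφv : ∀ w, φ x w = inner ℝ v w := fun w => by simp [hv]
  have hv0 : ‖v‖ ^ 2 ≠ 0 := by simpa [hv] using h0
  have hN : normSq (φ x) = ‖v‖ ^ 2 := normSq_eq _
  set V : ∀ y : M, TangentSpace I y := extend E v
  have hVx : V x = v := extend_apply_self E v
  have hVd : MDiffAt (T% V) x := mdifferentiableAt_extend I E v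
  have hg := mdiffAt_inner hVd hVd
  have hp := hφ.mdiffAt_apply hVd
  -- Cauchy–Schwarz: `|φ|²|V|² - φ(V)² ≥ 0`, with equality at `x` because `V x = φ♯`. The derivative
  -- of this difference vanishes at `x`, which gives `d|φ|²` without differentiating `φ♯` or an
  -- orthonormal frame.
  have hmin : IsLocalMin (fun y => normSq (φ y) * inner ℝ (V y) (V y)
      - φ y (V y) * φ y (V y)) x := by
    refine Filter.Eventually.of_forall fun y => ?_
    have h1 : normSq (φ x) * inner ℝ (V x) (V x) - φ x (V x) * φ x (V x) = 0 := by
      rw [hN, hVx, hφv, real_inner_self_eq_norm_sq]; ring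
    beta_reduce
    rw [h1, normSq_eq, real_inner_self_eq_norm_sq]
    have h2 : φ y (V y) =
        inner ℝ ((InnerProductSpace.toDual ℝ (TangentSpace I y)).symm (φ y)) (V y) := by simp
    have h3 := abs_real_inner_le_norm
      ((InnerProductSpace.toDual ℝ (TangentSpace I y)).symm (φ y)) (V y)
    rw [← h2] at h3
    have h4 := mul_self_le_mul_self (abs_nonneg _) h3
    rw [abs_mul_abs_self] at h4
    linarith
  have hz' := DFunLike.congr_fun
    (mvfderiv_eq_zero_of_isLocalMin ((hd.mul hg).sub (hp.mul hp)) hmin) u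
  have hmet : d% (fun y => inner ℝ (V y) (V y)) x u = 2 * inner ℝ v (leviCivita V x u) := by
    have := leviCivita_metric (mdifferentiableAt_extend I E u) hVd hVd
    rw [extend_apply_self, hVx, real_inner_comm] at this
    rw [this]; ring
  rw [mvfderiv_sub (hd.mul hg) (hp.mul hp), mvfderiv_mul hd hg, mvfderiv_mul hp hp] at hz'
  simp only [_root_.sub_apply, _root_.add_apply, _root_.smul_apply, smul_eq_mul, hmet, hVx, hN,
    hφv v, _root_.zero_apply] at hz'
  rw [real_inner_self_eq_norm_sq] at hz'
  have hc : covDeriv φ x u v =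
      d% (fun y => φ y (V y)) x u - inner ℝ v (leviCivita V x u) := by
    rw [covDeriv, hφv]
  rw [hc]
  -- The vanishing derivative carries a common factor `|φ|²` at `x`; this is where `φ x ≠ 0` is
  -- needed.
  apply mul_left_cancel₀ hv0
  linarith

end Riemannian


/-! ### The soliton equations when `Ric = c g`. -/

section Einstein

variable {E : Type*} [NormedAddCommGroup E] [NormedSpace ℝ E] [FiniteDimensional ℝ E]
  {H : Type*} [TopologicalSpace H] {I : ModelWithCorners ℝ E H}
  {M : Type*} [TopologicalSpace M] [ChartedSpace H M] [IsManifold I ∞ M]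
  [RiemannianBundle (fun x : M => TangentSpace I x)]

theorem toEnd_const_mul_inner (x : M) (c : ℝ) (u : TangentSpace I x) :
    toEnd x (fun u v => c * Inner.inner ℝ u v) u = c • u := by
  simp only [toEnd, mul_smul, ← Finset.smul_sum]
  congr 1
  conv_rhs => rw [← (stdOrthonormalBasis ℝ (TangentSpace I x)).sum_repr' u]
  simp [real_inner_comm]

theorem metricTrace_const_mul_inner (x : M) (c : ℝ) :
    metricTrace x (fun u v : TangentSpace I x => c * Inner.inner ℝ u v) = c * finrank ℝ E := by
  rw [← metricTrace_inner (I := I) x]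
  simp only [metricTrace, Finset.mul_sum]

/-- A multiple of the identity commutes with any map that respects scalars; as `τ` is a bare
function, homogeneity in its first slot has to be assumed. -/
theorem endCommutator_const_mul_inner (x : M) (τ : TangentSpace I x → TangentSpace I x → ℝ)
    (hτ : ∀ (a : ℝ) u v, τ (a • u) v = a * τ u v) (c : ℝ) (u v : TangentSpace I x) :
    endCommutator x τ (fun u v => c * Inner.inner ℝ u v) u v = 0 := by
  have h : toEnd x τ (c • u) = c • toEnd x τ u := by
    simp only [toEnd, hτ, mul_smul, Finset.smul_sum]
  rw [endCommutator, toEnd_const_mul_inner, toEnd_const_mul_inner, h, sub_self, inner_zero_left]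

variable [Fact (finrank ℝ E = 3)]

theorem hodgeStar_smul_left
    (o : ManifoldOrientation I M) {x : M} (α : TangentSpace I x →L[ℝ] ℝ) (a : ℝ)
    (u v : TangentSpace I x) : hodgeStar o α (a • u) v = a * hodgeStar o α u v := by
  have hupd : ∀ w u' : TangentSpace I x, ![w, u', v] = Function.update ![w, u, v] 1 u' := by
    intro w u'
    ext i
    fin_cases i <;> rfl
  rw [hodgeStar, hodgeStar, hupd, AlternatingMap.map_update_smul, ← hupd, smul_eq_mul]

variable [IsContMDiffRiemannianBundle I ∞ E (fun x : M => TangentSpace I x)]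
  {o : ManifoldOrientation I M} {κ : ℝ} {φ : ∀ x : M, TangentSpace I x →L[ℝ] ℝ} {f : M → ℝ}

theorem normSq_smul {x : M} (a : ℝ) (α : TangentSpace I x →L[ℝ] ℝ) :
    normSq (a • α) = a ^ 2 * normSq α := by
  simp only [normSq, metricTrace, Finset.mul_sum, _root_.smul_apply, smul_eq_mul]
  exact Finset.sum_congr rfl fun _ _ => by ring

/-- On an Einstein soliton with `Ric = c g`, the Einstein equation determines `∇φ`. -/
theorem IsHeteroticSoliton.covDeriv_eq (hsol : IsHeteroticSoliton o κ φ f) {c : ℝ}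
    (hc : ∀ (x : M) (u v : TangentSpace I x), ric x u v = c * inner ℝ u v)
    (x : M) (u v : TangentSpace I x) :
    covDeriv φ x u v =
      -(c + κ / 2 * c ^ 2 - κ / 2 * c * f x ^ 2 - 1 / 2 * f x ^ 2 + κ / 8 * f x ^ 4
        + κ / 4 * f x ^ 2 * normSq (φ x)) * inner ℝ u v
      - κ / 4 * f x ^ 2 * (φ x u * φ x v) := by
  have hdim : (finrank ℝ E : ℝ) = 3 := by exact_mod_cast Fact.out (p := finrank ℝ E = 3)
  have hric : ric (I := I) x = fun u v => c * Inner.inner ℝ u v := funext₂ (hc x)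
  have hsq : ricSq (I := I) x = fun u v => c ^ 2 * Inner.inner ℝ u v := by
    funext u v
    rw [ricSq, hric, toEnd_const_mul_inner, toEnd_const_mul_inner, inner_smul_left,
      inner_smul_right, RCLike.conj_to_real]
    ring
  have h := hsol.einstein_eq x u v
  rw [scal, normSqRic, hsq, hric, metricTrace_const_mul_inner, metricTrace_const_mul_inner,
    endCommutator_const_mul_inner x _ (hodgeStar_smul_left o _), ← hsol.maxwell_eq x,
    normSq_smul, hdim] at h
  simp only [_root_.smul_apply, smul_eq_mul] at h
  linear_combination h

/-- On an Einstein soliton with `Ric = c g`, the norm of `φ` is a function of the dilaton. -/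
theorem IsHeteroticSoliton.normSq_form (hsol : IsHeteroticSoliton o κ φ f) {c : ℝ}
    (hc : ∀ (x : M) (u v : TangentSpace I x), ric x u v = c * inner ℝ u v) (x : M) :
    (2 + 3 * κ * f x ^ 2) * normSq (φ x) =
      3 * c - 9 * (c + κ / 2 * c ^ 2 - κ / 2 * c * f x ^ 2 - 1 / 2 * f x ^ 2 + κ / 8 * f x ^ 4)
        + 1 / 2 * f x ^ 2 := by
  have hdim : (finrank ℝ E : ℝ) = 3 := by exact_mod_cast Fact.out (p := finrank ℝ E = 3)
  have hric : ric (I := I) x = fun u v => c * Inner.inner ℝ u v := funext₂ (hc x)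
  have h := hsol.dilaton_eq x
  have hcov : covDeriv φ x = _ := funext₂ (hsol.covDeriv_eq hc x)
  have htr : ∀ a b : ℝ, metricTrace x (fun u v : TangentSpace I x =>
      a * inner ℝ u v - b * (φ x u * φ x v)) = a * 3 - b * normSq (φ x) := by
    intro a b
    rw [← hdim, ← metricTrace_const_mul_inner (I := I) x a, normSq]
    simp only [metricTrace, Finset.mul_sum, Finset.sum_sub_distrib]
  rw [scal, hric, metricTrace_const_mul_inner, hdim, codiff, hcov, htr] at h
  linear_combination -h

/-- The polynomial relation satisfied by the dilaton of an Einstein soliton with `Ric = c g`, away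
from the zeros of `φ`. -/
noncomputable def dilatonPolynomial (κ c : ℝ) : Polynomial ℝ :=
  .C (9 / 8 * κ ^ 3) * .X ^ 8 + .C (-(9 / 2) * κ ^ 3 * c) * .X ^ 6
    + .C (3 * κ ^ 2 * c + 10 * κ + 9 / 2 * κ ^ 3 * c ^ 2) * .X ^ 4
    + .C (-(62 * κ * c + 30 * κ ^ 2 * c ^ 2 + 16)) * .X ^ 2
    + .C (-(8 * c + 4 * κ * c ^ 2))

/-- The leading coefficient does not involve `c`, so no Einstein constant is exceptional. -/
theorem dilatonPolynomial_ne_zero {κ : ℝ} (hκ : κ ≠ 0) (c : ℝ) : dilatonPolynomial κ c ≠ 0 := by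
  intro h0
  have h : (dilatonPolynomial κ c).coeff 8 = 9 / 8 * κ ^ 3 := by
    simp only [dilatonPolynomial, Polynomial.coeff_add, Polynomial.coeff_C_mul,
      Polynomial.coeff_X_pow, Polynomial.coeff_C]
    norm_num
  rw [h0, Polynomial.coeff_zero] at h
  exact pow_ne_zero 3 hκ (by linarith)

/-- Compares the two expressions for `d|φ|²`: the chain rule for `B(f)/D(f)`, and `2 ∇φ(·, φ♯)`. -/
theorem IsHeteroticSoliton.dilatonPolynomial_smul_eq_zero [I.Boundaryless]
    (hsol : IsHeteroticSoliton o κ φ f) (hκ : 0 < κ) {c : ℝ}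
    (hc : ∀ (x : M) (u v : TangentSpace I x), ric x u v = c * inner ℝ u v) (x : M) :
    (dilatonPolynomial κ c).eval (f x) • d% f x = 0 := by
  by_cases hφ : φ x = 0
  · rw [← hsol.maxwell_eq x, hφ, smul_zero, smul_zero]
  have hf : MDiffAt f x := (hsol.smooth_fun x).mdifferentiableAt (by simp)
  let B : ℝ → ℝ := fun y => 3 * c -
    9 * (c + κ / 2 * c ^ 2 - κ / 2 * c * y ^ 2 - 1 / 2 * y ^ 2 + κ / 8 * y ^ 4) + 1 / 2 * y ^ 2
  let D : ℝ → ℝ := fun y => 2 + 3 * κ * y ^ 2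
  have hD0 : ∀ y, D y ≠ 0 := fun y => by positivity
  have hS : (fun y => normSq (φ y)) = fun y => B (f y) / D (f y) := by
    funext y
    rw [eq_div_iff (hD0 _), mul_comm]
    exact hsol.normSq_form hc y
  have hB : ∀ y, HasDerivAt B
      (-9 * (-κ * c * y - y + κ / 2 * y ^ 3) + y) y := fun y => by
    have h2 : HasDerivAt (fun y : ℝ => y ^ 2) (2 * y) y := by simpa using hasDerivAt_pow 2 y
    have h4 : HasDerivAt (fun y : ℝ => y ^ 4) (4 * y ^ 3) y := by simpa using hasDerivAt_pow 4 y
    have := ((((((h2.const_mul (κ / 2 * c)).const_sub (c + κ / 2 * c ^ 2)).sub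
      (h2.const_mul (1 / 2))).add (h4.const_mul (κ / 8))).const_mul 9).const_sub (3 * c)).add
      (h2.const_mul (1 / 2))
    convert! this using 1
    ring
  have hD : ∀ y, HasDerivAt D (6 * κ * y) y := fun y => by
    have h2 : HasDerivAt (fun y : ℝ => y ^ 2) (2 * y) y := by simpa using hasDerivAt_pow 2 y
    convert! (h2.const_mul (3 * κ)).const_add 2 using 1
    ring
  -- This also supplies the differentiability of `|φ|²` that `mvfderiv_normSq` requires.
  obtain ⟨hSd, hS'⟩ := mvfderiv_comp_of_hasDerivAt ((hB (f x)).div (hD (f x)) (hD0 (f x))) hf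
  simp only [Pi.div_apply] at hSd hS'
  rw [← hS] at hSd hS'
  ext u
  have h1 := mvfderiv_normSq hsol.smooth_form hSd hφ u
  have hN := normSq_eq (φ x)
  set v := (InnerProductSpace.toDual ℝ (TangentSpace I x)).symm (φ x) with hv
  have hφv : φ x v = normSq (φ x) := by
    rw [hN, ← real_inner_self_eq_norm_sq]
    conv_rhs => rw [hv, InnerProductSpace.toDual_symm_apply]
  have huv : inner ℝ u v = φ x u := by
    rw [real_inner_comm, hv, InnerProductSpace.toDual_symm_apply]
  rw [hS', hsol.covDeriv_eq hc, hφv, huv, ← hsol.maxwell_eq x] at h1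
  have hSx : normSq (φ x) = B (f x) / D (f x) := congrFun hS x
  rw [hSx] at h1
  rw [← hsol.maxwell_eq x]
  simp only [_root_.smul_apply, smul_eq_mul, _root_.zero_apply] at h1 ⊢
  have hDx := hD0 (f x)
  rw [div_mul_eq_mul_div, div_eq_iff (pow_ne_zero 2 hDx)] at h1
  have hBD : B (f x) / D (f x) * D (f x) = B (f x) := div_mul_cancel₀ _ hDx
  simp only [dilatonPolynomial, Polynomial.eval_add, Polynomial.eval_mul, Polynomial.eval_C,
    Polynomial.eval_pow, Polynomial.eval_X]
  generalize B (f x) / D (f x) = S at h1 hBD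
  simp only [B, D] at h1 hBD
  -- The factor `f` turns `φ` into `df`; the `hBD` term eliminates `S = |φ|²` through `S D = B`.
  linear_combination (-f x) * h1 + κ * f x ^ 3 * (2 + 3 * κ * f x ^ 2) * φ x u * hBD

end Einstein

end HeteroticSoliton

/-- The dilaton of an Einstein three-dimensional Heterotic soliton is constant. -/
theorem mainTheorem2
    {M : Type*} [TopologicalSpace M] [T2Space M] [SecondCountableTopology M] [ConnectedSpace M]
    [ChartedSpace (EuclideanSpace ℝ (Fin 3)) M] [IsManifold (𝓡 3) ∞ M]
    [RiemannianBundle (fun x : M => TangentSpace (𝓡 3) x)]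
    [IsContMDiffRiemannianBundle (𝓡 3) ∞ (EuclideanSpace ℝ (Fin 3))
      (fun x : M => TangentSpace (𝓡 3) x)]
    (o : HeteroticSoliton.ManifoldOrientation (𝓡 3) M)
    (κ : ℝ) (hκ : 0 < κ)
    (φ : ∀ x : M, TangentSpace (𝓡 3) x →L[ℝ] ℝ) (f : M → ℝ)
    (hsol : HeteroticSoliton.IsHeteroticSoliton o κ φ f)
    (hE : HeteroticSoliton.IsEinstein (𝓡 3) M) :
    ∃ c : ℝ, ∀ x : M, f x = c := by
  obtain ⟨c, hc⟩ := hE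
  have : IsManifold (𝓡 3) 1 M := IsManifold.of_le (n := ∞) (by simp)
  exact HeteroticSoliton.exists_eq_const_of_polynomial_smul_mvfderiv_eq_zero
    (hsol.smooth_fun.mdifferentiable (by simp))
    (HeteroticSoliton.dilatonPolynomial_ne_zero hκ.ne' c)
    (hsol.dilatonPolynomial_smul_eq_zero hκ hc)
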